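/- For a (not necessarily commutative) ring $S$ with identity, let $J(S)$ be its Jacobson radical and put $J^{\#}(S)=\{s\in S \mid s^n\in J(S) \text{ for some integer } n\ge 1\}$. An element $a\in S$ is called strongly $J^{\#}$-clean if there is an idempotent $e\in S$ with $a-e\in J^{\#}(S)$ and $ea=ae$. A commutative ring $R$ with identity is called projective-free if every finitely generated projective $R$-module is free. **Theorem 3.1.** Let $R$ be a projective-free commutative ring, let $A(x)=(a_{ij}(x))\in M_2(R[[x]])$ be a $2\times 2$ matrix over the power series ring $R[[x]]$, and let $A(0)=(a_{ij}(0))\in M_2(R)$ be the matrix of constant terms. Then $A(x)$ is strongly $J^{\#}$-clean in $M_2(R[[x]])$ if and only if $A(0)$ is strongly $J^{\#}$-clean in $M_2(R)$. -/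

import Mathlib

universe u

/-- A commutative ring `R` is projective-free if every finitely generated projective `R`-module is
free. (Every finitely generated `R`-module is isomorphic to one in the universe of `R`.) -/
def IsProjectiveFree (R : Type u) [CommRing R] : Prop :=
  ∀ (M : Type u) [AddCommGroup M] [Module R M] [Module.Finite R M] [Module.Projective R M],
    Module.Free R M

/-- The set of elements of a (not necessarily commutative) ring having some positive power in the
Jacobson radical. -/
def jSharp (S : Type u) [Ring S] : Set S :=
  {x | ∃ n : ℕ, 0 < n ∧ x ^ n ∈ Ring.jacobson S}

/-- `a` is the sum of an idempotent and an element of `jSharp S` that commute. -/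
def IsStronglyJSharpClean {S : Type u} [Ring S] (a : S) : Prop :=
  ∃ e : S, IsIdempotentElem e ∧ a - e ∈ jSharp S ∧ e * a = a * e

/-!
Let `a = e + w` be a strongly `J#`-clean decomposition in an algebra integral over a commutative
ring `R`. Then `e` is a polynomial in `a`: there are `α` and `β` in `R[a]`, congruent to `1 - e`
and to `e` modulo multiples of `w`, with `α * e = 0` and `β * (1 - e) = 0`, so that `α + β` is a
unit and `(α + β) * e = β`; by integrality the inverse of a unit `u` lies in `R[u]`. If now `a` is
the constant coefficient of a power series `f`, the same polynomial in `f` lifts `e` to an element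
commuting with `f`, and Newton iteration turns this lift into an idempotent, still commuting with
`f`. Since a power series is a unit exactly when its constant coefficient is, `J#` is detected on
constant coefficients. Matrices over a commutative ring are integral over it by Cayley-Hamilton.
-/

section JacobsonRadical

variable {S T : Type*} [Ring S] [Ring T]

theorem isUnit_one_add_of_mem_jacobson {x : S} (hx : x ∈ Ring.jacobson S) : IsUnit (1 + x) := by
  have exists_left_inv {y : S} (hy : y ∈ Ring.jacobson S) : ∃ z, z * (1 + y) = 1 := by
    rw [← Ideal.jacobson_bot] at hy
    obtain ⟨z, hz⟩ := Ideal.mem_jacobson_iff.1 hy 1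
    exact ⟨z, by rwa [Ideal.mem_bot, mul_one, sub_eq_zero, add_comm, ← mul_one_add] at hz⟩
  obtain ⟨z, hz⟩ := exists_left_inv hx
  have hz_eq : z = 1 + -z * x := by rw [neg_mul, ← hz]; noncomm_ring
  obtain ⟨z', hz'⟩ := exists_left_inv (Ideal.mul_mem_left _ (-z) hx)
  rw [← hz_eq] at hz'
  exact ⟨⟨1 + x, z, by rwa [left_inv_eq_right_inv hz' hz] at hz', hz⟩, rfl⟩

theorem mem_jacobson_iff_map_mem (f : S →+* T) [IsLocalHom f] (hf : Function.Surjective f)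
    {x : S} : x ∈ Ring.jacobson S ↔ f x ∈ Ring.jacobson T := by
  have : RingHomSurjective f := ⟨hf⟩
  refine ⟨fun hx ↦ Ring.le_comap_jacobson f hx, fun hx ↦ ?_⟩
  rw [← Ideal.jacobson_bot, Ideal.mem_jacobson_iff]
  intro y
  have hunit : IsUnit (1 + y * x) := by
    refine isUnit_of_map_unit f _ ?_
    rw [map_add, map_one, map_mul]
    exact isUnit_one_add_of_mem_jacobson (Ideal.mul_mem_left _ _ hx)
  obtain ⟨z, hz⟩ := hunit.exists_left_inv
  exact ⟨z, by rw [Ideal.mem_bot, ← hz]; noncomm_ring⟩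

theorem mem_jSharp_iff_map_mem (f : S →+* T) [IsLocalHom f] (hf : Function.Surjective f)
    {x : S} : x ∈ jSharp S ↔ f x ∈ jSharp T := by
  simp only [jSharp, Set.mem_ofPred_eq, ← map_pow, mem_jacobson_iff_map_mem f hf]

theorem neg_mem_jSharp {w : S} (hw : w ∈ jSharp S) : -w ∈ jSharp S := by
  obtain ⟨n, hn, hwn⟩ := hw
  exact ⟨n, hn, neg_pow w n ▸ Ideal.mul_mem_left _ _ hwn⟩

theorem isUnit_one_sub_mul_of_mem_jSharp {c w : S} (hw : w ∈ jSharp S) (hcw : Commute c w) :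
    IsUnit (1 - c * w) := by
  obtain ⟨n, -, hn⟩ := hw
  have hpow : IsUnit (1 - (c * w) ^ n) := by
    rw [sub_eq_add_neg, hcw.mul_pow]
    exact isUnit_one_add_of_mem_jacobson (neg_mem (Ideal.mul_mem_left _ _ hn))
  have hcomm : Commute (1 - c * w) (∑ i ∈ Finset.range n, (c * w) ^ i) :=
    Commute.sum_right _ _ _ fun i _ ↦
      (Commute.one_left _).sub_left ((Commute.refl (c * w)).pow_right i)
  rw [← mul_neg_geom_sum] at hpow
  exact (hcomm.isUnit_mul_iff.1 hpow).1

theorem IsStronglyJSharpClean.map {a : S} (ha : IsStronglyJSharpClean a) (f : S →+* T)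
    (hf : Function.Surjective f) : IsStronglyJSharpClean (f a) := by
  have : RingHomSurjective f := ⟨hf⟩
  obtain ⟨e, he, ⟨n, hn, hw⟩, hea⟩ := ha
  refine ⟨f e, he.map f, ⟨n, hn, ?_⟩, by rw [← map_mul, hea, map_mul]⟩
  rw [← map_sub, ← map_pow]
  exact Ring.le_comap_jacobson f hw

theorem isStronglyJSharpClean_ringEquiv_iff (f : S ≃+* T) {a : S} :
    IsStronglyJSharpClean (f a) ↔ IsStronglyJSharpClean a :=
  ⟨fun h ↦ by simpa using h.map f.symm.toRingHom f.symm.surjective,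
    fun h ↦ h.map f.toRingHom f.surjective⟩

end JacobsonRadical

section Integral

variable {R S : Type*} [CommRing R] [Ring S] [Algebra R S]

theorem inv_mem_adjoin_of_isIntegral_inv (u : Sˣ) (hu : IsIntegral R (↑u⁻¹ : S)) :
    (↑u⁻¹ : S) ∈ Algebra.adjoin R {(u : S)} := by
  obtain ⟨f, hf, hroot⟩ := hu
  set n := f.natDegree
  have hpow : (↑u⁻¹ : S) ^ n = -∑ i ∈ Finset.range n, f.coeff i • (↑u⁻¹ : S) ^ i := by
    rw [← Polynomial.aeval_def, Polynomial.aeval_eq_sum_range, Finset.sum_range_succ,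
      hf.coeff_natDegree, one_smul] at hroot
    exact eq_neg_of_add_eq_zero_right hroot
  have hshift {i : ℕ} (hi : i ∈ Finset.range n) :
      (↑u⁻¹ : S) ^ i * ↑u⁻¹ * (u : S) ^ n = (u : S) ^ (n - (i + 1)) := by
    obtain ⟨k, hk⟩ := Nat.exists_eq_add_of_lt (Finset.mem_range.1 hi)
    have hn : n - (i + 1) = k := by omega
    rw [hn, hk]
    norm_cast
    group
  have hinv : (↑u⁻¹ : S) = -∑ i ∈ Finset.range n, f.coeff i • (u : S) ^ (n - (i + 1)) := by
    calc (↑u⁻¹ : S) = (↑u⁻¹ : S) ^ n * ↑u⁻¹ * (u : S) ^ n := by norm_cast; group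
      _ = _ := by
        rw [hpow, neg_mul, neg_mul, Finset.sum_mul, Finset.sum_mul]
        refine congrArg _ (Finset.sum_congr rfl fun i hi ↦ ?_)
        rw [smul_mul_assoc, smul_mul_assoc, hshift hi]
  rw [hinv]
  exact neg_mem <| sum_mem fun i _ ↦ Subalgebra.smul_mem _
    (pow_mem (Algebra.self_mem_adjoin_singleton R _) _) _

theorem exists_mem_adjoin_mul_eq_mul {e v a y : S} (hva : v * e = a * e) (hea : Commute e a)
    (hy : y ∈ Algebra.adjoin R {v}) : ∃ c ∈ Algebra.adjoin R {a}, y * e = c * e := by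
  induction hy using Algebra.adjoin_induction with
  | mem x hx =>
    obtain rfl := Set.mem_singleton_iff.1 hx
    exact ⟨a, Algebra.self_mem_adjoin_singleton R a, hva⟩
  | algebraMap r => exact ⟨algebraMap R S r, Subalgebra.algebraMap_mem _ r, rfl⟩
  | add x y _ _ hx hy =>
    obtain ⟨c, hc, hxc⟩ := hx
    obtain ⟨d, hd, hyd⟩ := hy
    exact ⟨c + d, add_mem hc hd, by rw [add_mul, add_mul, hxc, hyd]⟩
  | mul x y _ _ hx hy =>
    obtain ⟨c, hc, hxc⟩ := hx
    obtain ⟨d, hd, hyd⟩ := hy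
    have hed : Commute e d := Algebra.commute_of_mem_adjoin_singleton_of_commute hd hea
    refine ⟨c * d, mul_mem hc hd, ?_⟩
    rw [mul_assoc, hyd, ← hed.eq, ← mul_assoc, hxc, mul_assoc, hed.eq, ← mul_assoc]

variable [Algebra.IsIntegral R S]

theorem exists_mem_adjoin_mul_mul_eq_self {e a : S} (he : IsIdempotentElem e) (hea : Commute e a)
    (hunit : IsUnit (1 - e + e * a)) : ∃ c ∈ Algebra.adjoin R {a}, a * c * e = e := by
  -- `c` is a polynomial in `a` that agrees on the range of `e` with the inverse of `1 - e + e * a`.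
  obtain ⟨u, hu⟩ := hunit
  have hue : (u : S) * e = a * e := by
    rw [hu, add_mul, sub_mul, one_mul, he.eq, sub_self, zero_add, hea.eq, mul_assoc, he.eq]
  obtain ⟨c, hc, hinv⟩ := exists_mem_adjoin_mul_eq_mul hue hea
    (inv_mem_adjoin_of_isIntegral_inv (R := R) u (Algebra.IsIntegral.isIntegral _))
  have hec : Commute e c := Algebra.commute_of_mem_adjoin_singleton_of_commute hc hea
  refine ⟨c, hc, ?_⟩
  calc a * c * e = a * e * c := by rw [mul_assoc, ← hec.eq, mul_assoc]
    _ = u * (c * e) := by rw [← hue, mul_assoc, hec.eq]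
    _ = e := by rw [← hinv, Units.mul_inv_cancel_left]

theorem exists_mem_adjoin_mul_eq_zero {a e : S} (he : IsIdempotentElem e)
    (hw : a - e ∈ jSharp S) (hea : Commute e a) :
    ∃ α ∈ Algebra.adjoin R {a}, α * e = 0 ∧
      ∃ k, Commute k (a - e) ∧ α = 1 - e - k * (a - e) := by
  have hunit : IsUnit (1 - e + e * a) := by
    convert isUnit_one_sub_mul_of_mem_jSharp hw
      (hea.sub_right (Commute.refl e)).neg_left using 1
    rw [neg_mul, mul_sub, he.eq, sub_neg_eq_add]
    abel
  obtain ⟨c, hc, hace⟩ := exists_mem_adjoin_mul_mul_eq_self (R := R) he hea hunit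
  have hec : Commute e c := Algebra.commute_of_mem_adjoin_singleton_of_commute hc hea
  have hac : Commute a c :=
    Algebra.commute_of_mem_adjoin_singleton_of_commute hc (Commute.refl a)
  refine ⟨1 - a * c, sub_mem (one_mem _)
    (mul_mem (Algebra.self_mem_adjoin_singleton R a) hc), ?_, c * (1 - e), ?_, ?_⟩
  · rw [sub_mul, one_mul, hace, sub_self]
  · exact (hac.symm.sub_right hec.symm).mul_left
      (((Commute.one_left a).sub_left hea).sub_right ((Commute.one_left e).sub_left rfl))
  · have hcea : c * e * a = e := by rw [mul_assoc, hea.eq, ← mul_assoc, ← hac.eq, hace]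
    have hcee : c * e * e = c * e := by rw [mul_assoc, he.eq]
    calc 1 - a * c = 1 - e - (c * a - c * e - (c * e * a - c * e * e)) := by
          rw [hcea, hcee, hac.eq]; abel
      _ = 1 - e - c * (1 - e) * (a - e) := by noncomm_ring

theorem mem_adjoin_of_sub_mem_jSharp {a e : S} (he : IsIdempotentElem e)
    (hw : a - e ∈ jSharp S) (hea : Commute e a) : e ∈ Algebra.adjoin R {a} := by
  have hsub : 1 - a - (1 - e) = -(a - e) := by abel
  obtain ⟨α, hα, hαe, k, hk, hαk⟩ := exists_mem_adjoin_mul_eq_zero (R := R) he hw hea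
  obtain ⟨β, hβ, hβe, l, hl, hβl⟩ := exists_mem_adjoin_mul_eq_zero (R := R) he.one_sub
    (hsub ▸ neg_mem_jSharp hw)
    ((Commute.one_right _).sub_right ((Commute.one_left a).sub_left hea))
  rw [hsub] at hl hβl
  replace hβ : β ∈ Algebra.adjoin R {a} := Algebra.adjoin_singleton_le
    (sub_mem (one_mem _) (Algebra.self_mem_adjoin_singleton R a)) hβ
  obtain ⟨γ, hγ⟩ : IsUnit (α + β) := by
    convert isUnit_one_sub_mul_of_mem_jSharp hw (hk.sub_left (Commute.neg_right_iff.1 hl)) using 1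
    rw [hαk, hβl, sub_mul, mul_neg]
    abel
  have hγe : γ * e = β := by
    rw [mul_sub, mul_one, sub_eq_zero] at hβe
    rw [hγ, add_mul, hαe, zero_add, ← hβe]
  have hγ_inv : (↑γ⁻¹ : S) ∈ Algebra.adjoin R {a} :=
    Algebra.adjoin_singleton_le (hγ ▸ add_mem hα hβ)
      (inv_mem_adjoin_of_isIntegral_inv γ (Algebra.IsIntegral.isIntegral _))
  rw [← Units.inv_mul_cancel_left γ e, hγe]
  exact mul_mem hγ_inv hβ

end Integral

section PowerSeries

open PowerSeries

variable {S : Type*} [Ring S]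

theorem X_pow_add_dvd_mul {f g : S⟦X⟧} {m n : ℕ} (hf : X ^ m ∣ f) (hg : X ^ n ∣ g) :
    X ^ (m + n) ∣ f * g := by
  obtain ⟨p, rfl⟩ := hf
  obtain ⟨q, rfl⟩ := hg
  exact ⟨p * q, by rw [pow_add, mul_assoc, ← mul_assoc p, (commute_X_pow p n).eq]; noncomm_ring⟩

theorem X_pow_dvd_mul_left {f : S⟦X⟧} {n : ℕ} (g : S⟦X⟧) (hf : X ^ n ∣ f) : X ^ n ∣ g * f := by
  simpa using X_pow_add_dvd_mul (m := 0) (by simp) hf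

theorem eq_of_forall_X_pow_dvd_sub {f g : S⟦X⟧} (h : ∀ n : ℕ, X ^ n ∣ f - g) : f = g := by
  ext n
  rw [← sub_eq_zero, ← map_sub]
  exact X_pow_dvd_iff.1 (h (n + 1)) n n.lt_succ_self

theorem exists_forall_X_pow_dvd_sub (s : ℕ → S⟦X⟧) (hs : ∀ n, X ^ n ∣ s (n + 1) - s n) :
    ∃ f : S⟦X⟧, ∀ n, X ^ n ∣ f - s n := by
  refine ⟨mk fun m ↦ coeff m (s (m + 1)), fun n ↦ X_pow_dvd_iff.2 fun m hm ↦ ?_⟩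
  rw [map_sub, coeff_mk, sub_eq_zero]
  induction n, hm using Nat.le_induction with
  | base => rfl
  | succ n hmn ih =>
    rw [ih, ← sub_eq_zero, ← neg_eq_zero, ← map_sub, ← map_neg, neg_sub]
    exact X_pow_dvd_iff.1 (hs n) m hmn

/-- The Newton iteration for the equation `x ^ 2 = x`, started at `g`. -/
def idempotentNewton (g : S) (n : ℕ) : S :=
  (fun x ↦ 3 * x ^ 2 - 2 * x ^ 3)^[n] g

theorem idempotentNewton_succ (g : S) (n : ℕ) : idempotentNewton g (n + 1) =
    3 * idempotentNewton g n ^ 2 - 2 * idempotentNewton g n ^ 3 :=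
  Function.iterate_succ_apply' _ _ _

theorem commute_idempotentNewton {a g : S} (h : Commute a g) (n : ℕ) :
    Commute a (idempotentNewton g n) := by
  induction n with
  | zero => exact h
  | succ n ih =>
    rw [idempotentNewton_succ]
    exact ((Commute.ofNat_right a 3).mul_right (ih.pow_right 2)).sub_right
      ((Commute.ofNat_right a 2).mul_right (ih.pow_right 3))

theorem X_pow_succ_dvd_idempotentNewton_sq_sub {g : S⟦X⟧} (hg : X ∣ g ^ 2 - g) (n : ℕ) :
    X ^ (n + 1) ∣ idempotentNewton g n ^ 2 - idempotentNewton g n := by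
  induction n with
  | zero => simpa [idempotentNewton] using hg
  | succ n ih =>
    rw [idempotentNewton_succ]
    set x := idempotentNewton g n
    have hX : X ^ 1 ∣ x ^ 2 - x := (pow_dvd_pow X (by omega)).trans ih
    have hsq_sub : (3 * x ^ 2 - 2 * x ^ 3) ^ 2 - (3 * x ^ 2 - 2 * x ^ 3) =
        (x ^ 2 - x) * (x ^ 2 - x) * (4 * (x ^ 2 - x) - 3) := by noncomm_ring
    rw [hsq_sub]
    exact (X_pow_add_dvd_mul ih hX).mul_right _

theorem exists_isIdempotentElem_constantCoeff_eq {g : S⟦X⟧}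
    (hg : IsIdempotentElem (constantCoeff g)) :
    ∃ E : S⟦X⟧, IsIdempotentElem E ∧ constantCoeff E = constantCoeff g ∧
      ∀ a, Commute a g → Commute a E := by
  have hX : X ∣ g ^ 2 - g := by
    rw [X_dvd_iff, map_sub, map_pow, pow_two, hg.eq, sub_self]
  have hnewton (n : ℕ) :
      X ^ n ∣ idempotentNewton g n ^ 2 - idempotentNewton g n :=
    (pow_dvd_pow X n.le_succ).trans (X_pow_succ_dvd_idempotentNewton_sq_sub hX n)
  obtain ⟨E, hE⟩ := exists_forall_X_pow_dvd_sub (idempotentNewton g) fun n ↦ by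
    rw [idempotentNewton_succ]
    convert (hnewton n).mul_right (1 - 2 * idempotentNewton g n) using 1
    noncomm_ring
  have hcomm {a : S⟦X⟧} (ha : Commute a g) : Commute a E := by
    refine eq_of_forall_X_pow_dvd_sub fun n ↦ ?_
    convert dvd_sub (X_pow_dvd_mul_left a (hE n)) ((hE n).mul_right a) using 1
    rw [mul_sub, sub_mul, (commute_idempotentNewton ha n).eq, sub_sub_sub_cancel_right]
  have hEg : constantCoeff E = constantCoeff g := by
    have h := X_dvd_iff.1 (pow_one (X : S⟦X⟧) ▸ hE 1)
    rw [map_sub, sub_eq_zero] at h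
    rw [h, idempotentNewton_succ]
    simp only [idempotentNewton, Function.iterate_zero, id_eq, map_sub, map_mul, map_pow,
      map_ofNat, hg.pow_succ_eq]
    noncomm_ring
  refine ⟨E, eq_of_forall_X_pow_dvd_sub fun n ↦ ?_, hEg, fun a ↦ hcomm⟩
  set s := idempotentNewton g n
  have hmul_sub : E * E - E = (s ^ 2 - s) + (E - s) * E + s * (E - s) - (E - s) := by
    noncomm_ring
  rw [hmul_sub]
  exact dvd_sub (dvd_add (dvd_add (hnewton n) ((hE n).mul_right E))
    (X_pow_dvd_mul_left s (hE n))) (hE n)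

theorem isLocalHom_constantCoeff : IsLocalHom (constantCoeff (R := S)) :=
  ⟨fun _ h ↦ isUnit_iff_constantCoeff.2 h⟩

theorem exists_constantCoeff_eq_commute_of_mem_adjoin {R : Type*} [CommRing R] [Algebra R S]
    (a : S⟦X⟧) {y : S} (hy : y ∈ Algebra.adjoin R {constantCoeff a}) :
    ∃ g : S⟦X⟧, constantCoeff g = y ∧ Commute a g := by
  let π : S⟦X⟧ →ₐ[R] S :=
    { constantCoeff with commutes' := fun r ↦ by simp [PowerSeries.algebraMap_apply] }
  change y ∈ Algebra.adjoin R {π a} at hy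
  rw [← AlgHom.map_adjoin_singleton] at hy
  obtain ⟨g, hg, rfl⟩ := hy
  exact ⟨g, rfl, Algebra.commute_of_mem_adjoin_self hg⟩

theorem isStronglyJSharpClean_powerSeries_iff (R : Type*) [CommRing R] [Algebra R S]
    [Algebra.IsIntegral R S] (a : S⟦X⟧) :
    IsStronglyJSharpClean a ↔ IsStronglyJSharpClean (constantCoeff a) := by
  refine ⟨fun ha ↦ ha.map constantCoeff constantCoeff_surj, ?_⟩
  rintro ⟨e, he, hw, hea⟩
  obtain ⟨g, rfl, hag⟩ := exists_constantCoeff_eq_commute_of_mem_adjoin a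
    (mem_adjoin_of_sub_mem_jSharp (R := R) he hw hea)
  obtain ⟨E, hE, hEg, hcomm⟩ := exists_isIdempotentElem_constantCoeff_eq he
  have := isLocalHom_constantCoeff (S := S)
  refine ⟨E, hE, (mem_jSharp_iff_map_mem constantCoeff constantCoeff_surj).2 ?_, (hcomm a hag).symm⟩
  rwa [map_sub, hEg]

/-- The identification of matrices of power series with power series whose coefficients are
matrices. -/
noncomputable def matrixPowerSeriesEquiv (R n : Type*) [Semiring R] [Fintype n] [DecidableEq n] :
    Matrix n n R⟦X⟧ ≃+* (Matrix n n R)⟦X⟧ where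
  toFun A := mk fun k ↦ A.map (coeff k)
  invFun f := Matrix.of fun i j ↦ mk fun k ↦ coeff k f i j
  left_inv A := by ext; simp
  right_inv f := by ext; simp
  map_add' A B := by ext; simp
  map_mul' A B := by
    ext k i j
    simp only [coeff_mk, Matrix.map_apply, Matrix.mul_apply, map_sum, coeff_mul, Matrix.sum_apply]
    exact Finset.sum_comm

end PowerSeries

theorem theorem3p1_general {R n : Type*} [CommRing R] [Fintype n] [DecidableEq n]
    (A : Matrix n n (PowerSeries R)) :
    IsStronglyJSharpClean A ↔
      IsStronglyJSharpClean (A.map (PowerSeries.constantCoeff (R := R))) := by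
  have hA : PowerSeries.constantCoeff (matrixPowerSeriesEquiv R n A) =
      A.map (PowerSeries.constantCoeff (R := R)) := by
    ext; simp [matrixPowerSeriesEquiv]
  rw [← isStronglyJSharpClean_ringEquiv_iff (matrixPowerSeriesEquiv R n),
    isStronglyJSharpClean_powerSeries_iff R, hA]

theorem theorem3p1 (R : Type u) [CommRing R] (hR : IsProjectiveFree R)
    (A : Matrix (Fin 2) (Fin 2) (PowerSeries R)) :
    IsStronglyJSharpClean A ↔
      IsStronglyJSharpClean (A.map (PowerSeries.constantCoeff (R := R))) :=
  theorem3p1_general A
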